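/- There is an absolute constant $K>0$ such that the following holds for all integers $n\ge 0$, $k\ge 1$ and $t_1,\dots,t_k\ge 0$. There is a quantum algorithm $\mathcal A$, depending only on $n,k,t_1,\dots,t_k$, that evaluates every Boolean function $F:\{0,1\}^n\to\{0,1\}$ represented by a Zhegalkin polynomial of this shape, $$F(x)=a\oplus\bigoplus_{i=1}^{k}C_i(x),\qquad a\in\{0,1\},\qquad C_i(x)=\bigwedge_{z=1}^{t_i}x_{j_{i,z}},\qquad j_{i,z}\in\{1,\dots,n\}$$ (an empty conjunction is $1$). The running time of $\mathcal A$ is at most $$K\sqrt{k\log k\,(k+t_1+\dots+t_k)},$$ and for every such polynomial and every $x\in\{0,1\}^n$ the probability that $\mathcal A$ returns a bit other than $F(x)$ is at most $K/k$. Here a quantum algorithm is a classical loop that runs a fixed sequence of subroutines of the quantum query model (arbitrary input-independent unitaries alternating with queries, then a measurement that yields one bit) and stores each output bit in an array, initially $0$; one cell of the array is returned at the end. The polynomial and the input are given by a black box, which also holds the array: a query $|q,b\rangle\mapsto|q,b+v_q\rangle$, with addition modulo the size of the alphabet, reads in superposition the value $v_q$ at a location $q$, which is the constant $a$, an index $j_{i,z}$,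 a variable $x_v$ or a stored bit. The running time is the total number of queries to the black box. -/

import Mathlib

/-!
# Quantum query algorithms with stored classical data, and Zhegalkin polynomials

A black box holds a finite family of values: location `q : Q` holds an element of `Fin (d q)`.
-/

/-- Basis states of a query subroutine: a query register holding a location `q`, an answer register
with values in `Fin (d q)`, and a work register with `w` basis states. -/
abbrev QueryBasis {Q : Type} (d : Q → ℕ) (w : ℕ) : Type := (Σ q : Q, Fin (d q)) × Fin w

/-- The black box `z` on basis states: `|q, b, c⟩ ↦ |q, b + z q mod d q, c⟩`. -/
def oracleMap {Q : Type} {d : Q → ℕ} (w : ℕ) (z : ∀ q, Fin (d q)) (s : QueryBasis d w) :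
    QueryBasis d w :=
  (⟨s.1.1, s.1.2 + z s.1.1⟩, s.2)

/-- One query to the black box `z`, as a (permutation) matrix. -/
def oracleMatrix {Q : Type} [DecidableEq Q] {d : Q → ℕ} (w : ℕ) (z : ∀ q, Fin (d q)) :
    Matrix (QueryBasis d w) (QueryBasis d w) ℂ :=
  fun r s => if r = oracleMap w z s then 1 else 0

/-- An algorithm of the quantum query model with a one-bit output: from the basis state `start`, it
applies `gate 0`, a query, `gate 1`, a query, ..., a query, `gate queries`, where the gates are
arbitrary unitaries independent of the black box; then it measures all registers in the
computational basis and computes the output bit `out` from the result of the measurement. -/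
structure QuerySubroutine {Q : Type} [Fintype Q] [DecidableEq Q] (d : Q → ℕ) where
  work : ℕ
  queries : ℕ
  start : QueryBasis d work
  gate : ℕ → Matrix.unitaryGroup (QueryBasis d work) ℂ
  out : QueryBasis d work → Bool

namespace QuerySubroutine

variable {Q : Type} [Fintype Q] [DecidableEq Q] {d : Q → ℕ}

/-- The state after `i` queries to the black box `z` (and the gate that follows). -/
noncomputable def state (A : QuerySubroutine d) (z : ∀ q, Fin (d q)) :
    ℕ → (QueryBasis d A.work → ℂ)
  | 0 => (A.gate 0).1.mulVec (Pi.single A.start 1)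
  | i + 1 => (A.gate (i + 1)).1.mulVec ((oracleMatrix A.work z).mulVec (A.state z i))

/-- The probability that the subroutine outputs `b` on the black box `z` (Born rule). -/
noncomputable def outProb (A : QuerySubroutine d) (z : ∀ q, Fin (d q)) (b : Bool) : ℝ :=
  ∑ s : QueryBasis d A.work, if A.out s = b then ‖A.state z A.queries s‖ ^ 2 else 0

end QuerySubroutine

/-- A bit as an element of `Fin 2`. -/
def bitVal (b : Bool) : Fin 2 := if b then 1 else 0

/-- The sizes of the alphabets of a black box that gives access to the input locations `Q` and also
to `m` stored bits. -/
def withMemory {Q : Type} (d : Q → ℕ) (m : ℕ) : Q ⊕ Fin m → ℕ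
  | Sum.inl q => d q
  | Sum.inr _ => 2

/-- The black box that gives access to the input `z` and to the stored bits `μ`. -/
def joinMemory {Q : Type} {d : Q → ℕ} {m : ℕ} (z : ∀ q, Fin (d q)) (μ : Fin m → Bool) :
    ∀ q : Q ⊕ Fin m, Fin (withMemory d m q)
  | Sum.inl q => z q
  | Sum.inr c => bitVal (μ c)

/-- A quantum algorithm: a classical loop that calls quantum query subroutines one after the other.
The black box gives access to the input and to an array of `mem` stored bits, initially all `0`.
Each step `(A, c)` runs `A` on the current black box, with fresh registers, and stores the output
bit of `A` in the cell `c`. At the end the bit in the cell `result` is returned. -/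
structure QuantumAlgorithm {Q : Type} [Fintype Q] [DecidableEq Q] (d : Q → ℕ) where
  mem : ℕ
  steps : List (QuerySubroutine (withMemory d mem) × Fin mem)
  result : Fin mem

namespace QuantumAlgorithm

variable {Q : Type} [Fintype Q] [DecidableEq Q] {d : Q → ℕ}

/-- The running time: the total number of queries to the black box, which includes the queries to
the input and the queries to the stored bits. -/
def runningTime (A : QuantumAlgorithm d) : ℕ := (A.steps.map fun s => s.1.queries).sum

/-- The probability that the steps `l`, started with the stored bits `μ`, end with the bit `b` in
the cell `r`. -/
noncomputable def runProb {m : ℕ} (z : ∀ q, Fin (d q)) (r : Fin m) (b : Bool) :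
    List (QuerySubroutine (withMemory d m) × Fin m) → (Fin m → Bool) → ℝ
  | [], μ => if μ r = b then 1 else 0
  | s :: l, μ => ∑ v : Bool,
      s.1.outProb (joinMemory z μ) v * runProb z r b l (Function.update μ s.2 v)

/-- The probability that the algorithm returns `b` on the input `z`. -/
noncomputable def returnProb (A : QuantumAlgorithm d) (z : ∀ q, Fin (d q)) (b : Bool) : ℝ :=
  runProb z A.result b A.steps (fun _ => false)

/-- The probability that the algorithm, on the input `z`, returns a bit other than `v`. -/
noncomputable def errorProb (A : QuantumAlgorithm d) (z : ∀ q, Fin (d q)) (v : Bool) : ℝ :=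
  A.returnProb z (!v)

end QuantumAlgorithm

/-- A Zhegalkin polynomial `a ⊕ C₁ ⊕ ⋯ ⊕ C_k` in `n` variables, where `C_i` is the conjunction of
the `t i` variables with the indices `idx i 0, idx i 1, ...`. -/
structure ZhegalkinPoly (n k : ℕ) (t : Fin k → ℕ) where
  a : Bool
  idx : ∀ i : Fin k, Fin (t i) → Fin n

namespace ZhegalkinPoly

variable {n k : ℕ} {t : Fin k → ℕ}

/-- The value of the conjunction `C_i`; an empty conjunction is true. -/
def conj (P : ZhegalkinPoly n k t) (i : Fin k) (x : Fin n → Bool) : Bool :=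
  decide (∀ z : Fin (t i), x (P.idx i z) = true)

/-- The value `a ⊕ C₁ ⊕ ⋯ ⊕ C_k`. -/
def eval (P : ZhegalkinPoly n k t) (x : Fin n → Bool) : Bool :=
  (List.ofFn fun i : Fin k => P.conj i x).foldl xor P.a

/-- `F` is represented by `P`. -/
def Represents (P : ZhegalkinPoly n k t) (F : (Fin n → Bool) → Bool) : Prop :=
  ∀ x, F x = P.eval x

/-- The locations of the black box: the constant term, the entries of the lists of variables of the
conjunctions (an adjacency list for each conjunction), and the variables. -/
abbrev Loc (n k : ℕ) (t : Fin k → ℕ) : Type := Unit ⊕ (Σ i : Fin k, Fin (t i)) ⊕ Fin n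

/-- An entry of a list is the index of a variable; the other values are bits. -/
def locSize (n k : ℕ) (t : Fin k → ℕ) : Loc n k t → ℕ
  | Sum.inl _ => 2
  | Sum.inr (Sum.inl _) => n
  | Sum.inr (Sum.inr _) => 2

/-- The black box for the polynomial `P` and the values `x` of the variables. -/
def input (P : ZhegalkinPoly n k t) (x : Fin n → Bool) :
    ∀ q : Loc n k t, Fin (locSize n k t q)
  | Sum.inl _ => bitVal P.a
  | Sum.inr (Sum.inl e) => P.idx e.1 e.2
  | Sum.inr (Sum.inr v) => bitVal (x v)

end ZhegalkinPoly

/-!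
# Fast evaluation of Zhegalkin polynomials by Grover search

Write `N = t_i` for the length of a conjunction `C_i`. It is false iff one of its `N` positions holds
a false variable, so its value is found by a search. If the number `s` of such positions is known,
Grover's algorithm, with the initial amplitudes tuned by an additional flag, finds one of them with
certainty in `O(√(N / s))` queries; if the assumed number `g` satisfies `g ≤ s ≤ 2 g`, the same
algorithm still succeeds with probability at least `1 / 2` (`ZhegalkinPoly.exists_conjSearch`). As
the bit at the measured position is read again at the end, no search ever reports a false variable
for a true conjunction.

Put `L = 2 ⌈log₂ k⌉`. Searching once with each guess `1, …, min L N`, and `L` times with each guess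
`L · 2 ^ e ≤ N`, misses with probability at most `2⁻ᴸ ≤ k⁻²` (`prod_missBound_guesses_le`) and costs
only `O(√(N L))` queries (`sum_sqrt_div_guesses_le`), which is better than the `O(√N · L)` of
repeating a search of constant error. The classical loop stores for every conjunction the
disjunction of its search results, and adds up the values at the end. A potential function, the sum
over the conjunctions of the probability that the remaining searches miss, bounds the total error by
`k · k⁻² = 1 / k` (`QuantumAlgorithm.runProb_orSteps_le`), and by the Cauchy-Schwarz inequality the
total cost is `∑ O(√(t_i L)) + O(k) = O(√(k log k (k + ∑ t_i)))`.
-/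

open scoped Matrix

/-! ### Gates, states and the Born rule -/

/-- A basis permutation, and hence a gate, may be prescribed on any family of distinct basis states,
as long as the prescribed values are distinct too. -/
theorem exists_perm_extending {ι β : Type} [Finite β] (f g : ι → β)
    (hf : Function.Injective f) (hg : Function.Injective g) :
    ∃ σ : Equiv.Perm β, ∀ i, σ (f i) = g i := by
  classical
  have := Fintype.ofFinite β
  let e : {x // x ∈ Set.range f} ≃ {x // x ∈ Set.range g} :=
    (Equiv.ofInjective f hf).symm.trans (Equiv.ofInjective g hg)
  refine ⟨e.extendSubtype, fun i => ?_⟩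
  rw [Equiv.extendSubtype_apply_of_mem e (f i) ⟨i, rfl⟩]
  simp only [e, Equiv.trans_apply]
  rw [Equiv.ofInjective_symm_apply hf i, Equiv.ofInjective_apply]

section Gates

variable {β : Type}

/-- A real vector as a state with real amplitudes. All states of the search have real amplitudes. -/
noncomputable def toComplex (v : β → ℝ) : β → ℂ := fun s => (v s : ℂ)

theorem toComplex_dotProduct [Fintype β] (v w : β → ℝ) :
    toComplex v ⬝ᵥ toComplex w = ((v ⬝ᵥ w : ℝ) : ℂ) := by
  simp [toComplex, dotProduct]

variable [DecidableEq β]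

section Matrices

variable [Fintype β]

/-- The matrix that sends the basis state `s` to `f s`. `oracleMatrix` is the case
`f = oracleMap w z`. -/
def mapMatrix (f : β → β) : Matrix β β ℂ := fun r s => if r = f s then 1 else 0

theorem mapMatrix_mulVec_single (f : β → β) (s : β) :
    (mapMatrix f).mulVec (Pi.single s 1) = Pi.single (f s) 1 := by
  rw [Matrix.mulVec_single_one]
  ext r
  simp [mapMatrix, Matrix.col, Pi.single_apply]

theorem mapMatrix_mem_unitaryGroup {f : β → β} (hf : Function.Injective f) :
    mapMatrix f ∈ Matrix.unitaryGroup β ℂ := by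
  rw [Matrix.mem_unitaryGroup_iff']
  ext r s
  simp only [Matrix.mul_apply, Matrix.star_apply, mapMatrix, Matrix.one_apply]
  by_cases h : r = s
  · subst h; simp
  · have : f s ≠ f r := fun e => h (hf e).symm
    simp [h, this]

/-- The gate that permutes the basis states by `σ`. -/
def permGate (σ : Equiv.Perm β) : Matrix.unitaryGroup β ℂ :=
  ⟨mapMatrix σ, mapMatrix_mem_unitaryGroup σ.injective⟩

theorem permGate_mulVec_single (σ : Equiv.Perm β) (s : β) :
    (permGate σ).1.mulVec (Pi.single s 1) = Pi.single (σ s) 1 :=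
  mapMatrix_mulVec_single σ s

open Classical in
/-- The gate that changes the sign of the basis states in `S`. -/
noncomputable def phaseGate (S : Set β) : Matrix.unitaryGroup β ℂ :=
  ⟨Matrix.diagonal fun s => if s ∈ S then -1 else 1, by
    rw [Matrix.mem_unitaryGroup_iff', Matrix.star_eq_conjTranspose, Matrix.diagonal_conjTranspose,
      Matrix.diagonal_mul_diagonal, ← Matrix.diagonal_one]
    congr 1
    ext s
    by_cases h : s ∈ S <;> simp [h]⟩

open Classical in
theorem phaseGate_mulVec_single (S : Set β) (s : β) :
    (phaseGate S).1.mulVec (Pi.single s 1) =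
      ((if s ∈ S then -1 else 1 : ℝ) : ℂ) • Pi.single s (1 : ℂ) := by
  simp only [phaseGate]
  rw [Matrix.mulVec_single_one]
  ext r
  by_cases h : r = s
  · subst h
    by_cases hr : r ∈ S <;> simp [Matrix.col, hr]
  · simp [Matrix.col, h]

/-- The reflection `1 - 2 v vᵀ / ‖v‖²` in the hyperplane orthogonal to `v`. For `v = 0` the division
by zero makes it the identity, so it is unitary for every `v`. -/
noncomputable def householder (v : β → ℝ) : Matrix β β ℂ :=
  1 - ((2 / (v ⬝ᵥ v) : ℝ) : ℂ) • Matrix.vecMulVec (toComplex v) (toComplex v)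

theorem householder_mulVec (v w : β → ℝ) :
    (householder v).mulVec (toComplex w) = toComplex (w - (2 * (v ⬝ᵥ w) / (v ⬝ᵥ v)) • v) := by
  rw [householder, Matrix.sub_mulVec, Matrix.one_mulVec, Matrix.smul_mulVec,
    Matrix.vecMulVec_mulVec, toComplex_dotProduct]
  ext s
  simp [toComplex]
  ring

theorem householder_mem_unitaryGroup (v : β → ℝ) :
    householder v ∈ Matrix.unitaryGroup β ℂ := by
  have hs : star (householder v) = householder v := by
    ext r s
    simp [householder, Matrix.star_apply, Matrix.vecMulVec_apply, toComplex, Matrix.one_apply,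
      eq_comm, mul_comm, apply_ite]
  rw [Matrix.mem_unitaryGroup_iff', hs]
  have key : Matrix.vecMulVec (toComplex v) (toComplex v) *
      Matrix.vecMulVec (toComplex v) (toComplex v) =
      ((v ⬝ᵥ v : ℝ) : ℂ) • Matrix.vecMulVec (toComplex v) (toComplex v) := by
    rw [Matrix.vecMulVec_mul_vecMulVec, toComplex_dotProduct]
    ext r s
    simp [Matrix.vecMulVec_apply]
    ring
  rw [householder, sub_mul, one_mul, mul_sub, mul_one, Matrix.smul_mul, Matrix.mul_smul, key,
    smul_smul, smul_smul, ← Complex.ofReal_mul, ← Complex.ofReal_mul]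
  by_cases h : v ⬝ᵥ v = 0
  · simp [h]
  · have : 2 / (v ⬝ᵥ v) * (2 / (v ⬝ᵥ v)) * (v ⬝ᵥ v) = 2 * (2 / (v ⬝ᵥ v)) := by
      field_simp
    rw [this]
    ext r s
    simp
    ring

/-- The reflection in the hyperplane orthogonal to `v`, as a gate. -/
noncomputable def reflectionGate (v : β → ℝ) : Matrix.unitaryGroup β ℂ :=
  ⟨householder v, householder_mem_unitaryGroup v⟩

/-- For vectors of equal length, the reflection along their difference takes one to the other.
This prepares the initial state of the search. -/
theorem reflectionGate_sub_mulVec {v w : β → ℝ} (h : v ⬝ᵥ v = w ⬝ᵥ w) :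
    (reflectionGate (v - w)).1.mulVec (toComplex v) = toComplex w := by
  change (householder (v - w)).mulVec (toComplex v) = toComplex w
  rw [householder_mulVec]
  congr 1
  by_cases h0 : (v - w) ⬝ᵥ (v - w) = 0
  · have : v - w = 0 := dotProduct_self_eq_zero.1 h0
    rw [this, smul_zero, sub_zero, sub_eq_zero.1 this]
  · have : 2 * ((v - w) ⬝ᵥ v) = (v - w) ⬝ᵥ (v - w) := by
      simp only [sub_dotProduct, dotProduct_sub]
      rw [dotProduct_comm v w]
      linarith
    rw [this, div_self h0, one_smul, sub_sub_cancel]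

theorem sum_norm_sq_mulVec {U : Matrix β β ℂ} (hU : U ∈ Matrix.unitaryGroup β ℂ) (x : β → ℂ) :
    ∑ s, ‖U.mulVec x s‖ ^ 2 = ∑ s, ‖x s‖ ^ 2 := by
  have h : ∀ y : β → ℂ, ((∑ s, ‖y s‖ ^ 2 : ℝ) : ℂ) = star y ⬝ᵥ y := by
    intro y
    simp only [dotProduct, Pi.star_apply, RCLike.star_def, Complex.conj_mul']
    push_cast; rfl
  apply Complex.ofReal_injective
  rw [h, h, Matrix.star_mulVec, Matrix.dotProduct_mulVec, Matrix.vecMul_vecMul,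
    ← Matrix.star_eq_conjTranspose, Matrix.mem_unitaryGroup_iff'.1 hU, Matrix.vecMul_one]

end Matrices

variable {Λ : Type} [Fintype Λ]

/-- The state `∑ l, c l |e l⟩`. -/
noncomputable def superposition (e : Λ → β) (c : Λ → ℝ) : β → ℂ :=
  ∑ l, (c l : ℂ) • Pi.single (e l) (1 : ℂ)

theorem superposition_eq_toComplex (e : Λ → β) (c : Λ → ℝ) :
    superposition e c = toComplex (∑ l, c l • Pi.single (e l) (1 : ℝ)) := by
  ext s
  simp [superposition, toComplex, Finset.sum_apply, Pi.single_apply, apply_ite]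

theorem superposition_apply_of_injective {e : Λ → β} (he : Function.Injective e) (c : Λ → ℝ)
    (l : Λ) : superposition e c (e l) = c l := by
  classical
  simp [superposition, Finset.sum_apply, Pi.single_apply, he.eq_iff]

variable [Fintype β]

theorem mulVec_superposition {M : Matrix β β ℂ} {e e' : Λ → β} {a : Λ → ℝ} (c : Λ → ℝ)
    (h : ∀ l, M.mulVec (Pi.single (e l) 1) = (a l : ℂ) • Pi.single (e' l) (1 : ℂ)) :
    M.mulVec (superposition e c) = superposition e' (fun l => a l * c l) := by
  simp only [superposition]
  rw [Matrix.mulVec_sum]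
  refine Finset.sum_congr rfl fun l _ => ?_
  rw [Matrix.mulVec_smul, h, smul_smul]
  push_cast
  rw [mul_comm]

theorem mulVec_superposition_of_map {M : Matrix β β ℂ} {e e' : Λ → β} (c : Λ → ℝ)
    (h : ∀ l, M.mulVec (Pi.single (e l) 1) = Pi.single (e' l) (1 : ℂ)) :
    M.mulVec (superposition e c) = superposition e' c := by
  have := mulVec_superposition (a := fun _ => 1) (e' := e') c (fun l => by rw [h l]; simp)
  simpa using this

/-- The Born rule for a superposition of distinct basis states. -/
theorem sum_superposition {e : Λ → β} (he : Function.Injective e) (c : Λ → ℝ) (o : β → Bool)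
    (b : Bool) :
    (∑ s, if o s = b then ‖superposition e c s‖ ^ 2 else 0) =
      ∑ l, if o (e l) = b then c l ^ 2 else 0 := by
  classical
  have h0 : ∀ s, s ∉ Set.range e → superposition e c s = 0 := by
    intro s hs
    simp only [superposition, Finset.sum_apply, Pi.smul_apply, Pi.single_apply, smul_eq_mul]
    refine Finset.sum_eq_zero fun l _ => ?_
    rw [if_neg (fun h => hs ⟨l, h.symm⟩), mul_zero]
  refine (Finset.sum_of_injOn e he.injOn (by simp) (fun s _ hs => ?_) fun l _ => ?_).symm
  · rw [h0 s (by simpa using hs)]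
    simp
  · simp [superposition_apply_of_injective he]

theorem real_superposition_dotProduct {e : Λ → β} (he : Function.Injective e) (c c' : Λ → ℝ) :
    (∑ l, c l • Pi.single (e l) (1 : ℝ)) ⬝ᵥ (∑ l, c' l • Pi.single (e l) (1 : ℝ)) =
      ∑ l, c l * c' l := by
  classical
  simp [dotProduct_sum, Pi.single_apply, he.eq_iff, mul_comm]

end Gates

section Subroutine

variable {Q : Type} {d : Q → ℕ}

theorem oracleMap_injective (w : ℕ) (z : ∀ q, Fin (d q)) :
    Function.Injective (oracleMap (d := d) w z) := by
  rintro ⟨⟨q, b⟩, c⟩ ⟨⟨q', b'⟩, c'⟩ h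
  simp only [oracleMap, Prod.mk.injEq, Sigma.mk.injEq] at h
  obtain ⟨⟨rfl, h⟩, rfl⟩ := h
  have h := eq_of_heq h
  have : b = b' := by
    have key : ∀ (n : ℕ) (b b' y : Fin n), b + y = b' + y → b = b' := by
      intro n b b' y h
      cases n with
      | zero => exact b.elim0
      | succ n => exact add_right_cancel h
    exact key _ b b' _ h
  rw [this]

variable [Fintype Q] [DecidableEq Q]

theorem oracleMatrix_mulVec_single (w : ℕ) (z : ∀ q, Fin (d q)) (s : QueryBasis d w) :
    (oracleMatrix w z).mulVec (Pi.single s 1) = Pi.single (oracleMap w z s) 1 :=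
  mapMatrix_mulVec_single _ s

namespace QuerySubroutine

theorem sum_norm_sq_state (A : QuerySubroutine d) (z : ∀ q, Fin (d q)) (i : ℕ) :
    ∑ s, ‖A.state z i s‖ ^ 2 = 1 := by
  induction i with
  | zero =>
    rw [state, sum_norm_sq_mulVec (A.gate 0).2]
    simp [Pi.single_apply, apply_ite]
  | succ i ih =>
    rw [state, sum_norm_sq_mulVec (A.gate (i + 1)).2]
    exact (sum_norm_sq_mulVec
      (mapMatrix_mem_unitaryGroup (oracleMap_injective A.work z)) _).trans ih

theorem outProb_nonneg (A : QuerySubroutine d) (z : ∀ q, Fin (d q)) (b : Bool) :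
    0 ≤ A.outProb z b :=
  Finset.sum_nonneg fun s _ => by split_ifs <;> positivity

theorem outProb_true_add_false (A : QuerySubroutine d) (z : ∀ q, Fin (d q)) :
    A.outProb z true + A.outProb z false = 1 := by
  rw [outProb, outProb, ← Finset.sum_add_distrib, ← A.sum_norm_sq_state z A.queries]
  refine Finset.sum_congr rfl fun s _ => ?_
  cases A.out s <;> simp

end QuerySubroutine

end Subroutine

/-! ### Grover's iteration -/

section Grover

variable {Λ : Type} [Fintype Λ]

/-- The phase `-1` on marked labels and `1` on the others. -/
def markSign (M : Λ → Prop) [DecidablePred M] (l : Λ) : ℝ := if M l then -1 else 1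

/-- The amplitudes after `r` Grover iterations that start with the amplitudes `p`: each iteration
multiplies by the phases `s` and then reflects in the hyperplane orthogonal to `p`. (The usual
diffusion operator is the negative of this reflection; the global sign is immaterial.) -/
noncomputable def groverCoeff (p s : Λ → ℝ) : ℕ → Λ → ℝ
  | 0 => p
  | r + 1 => fun l =>
      s l * groverCoeff p s r l - 2 * (∑ l', p l' * (s l' * groverCoeff p s r l')) * p l

theorem sum_not_marked_sq {p : Λ → ℝ} (M : Λ → Prop) [DecidablePred M] {θ : ℝ}
    (hp : ∑ l, p l ^ 2 = 1) (hM : (∑ l, if M l then p l ^ 2 else 0) = Real.sin θ ^ 2) :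
    (∑ l, if M l then 0 else p l ^ 2) = Real.cos θ ^ 2 := by
  have h : (∑ l, if M l then p l ^ 2 else 0) + (∑ l, if M l then 0 else p l ^ 2) = 1 := by
    rw [← Finset.sum_add_distrib, ← hp]
    exact Finset.sum_congr rfl fun l _ => by split_ifs <;> simp
  linarith [Real.sin_sq_add_cos_sq θ]

/-- If the marked labels carry the weight `sin² θ` in the initial state, then Grover's iteration is
a rotation by `2θ` in the plane spanned by the marked and the unmarked part of that state. -/
theorem groverCoeff_eq {p : Λ → ℝ} (M : Λ → Prop) [DecidablePred M] {θ : ℝ}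
    (hp : ∑ l, p l ^ 2 = 1) (hM : (∑ l, if M l then p l ^ 2 else 0) = Real.sin θ ^ 2)
    (hs : Real.sin θ ≠ 0) (hc : Real.cos θ ≠ 0) (r : ℕ) (l : Λ) :
    groverCoeff p (markSign M) r l =
      (-1) ^ r * (if M l then Real.sin ((2 * r + 1) * θ) / Real.sin θ
        else Real.cos ((2 * r + 1) * θ) / Real.cos θ) * p l := by
  have hM' := sum_not_marked_sq M hp hM
  induction r generalizing l with
  | zero => simp [groverCoeff, div_self hs, div_self hc]
  | succ r ih =>
    set a := Real.sin ((2 * r + 1) * θ) with ha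
    set b := Real.cos ((2 * r + 1) * θ) with hb
    have hsum : (∑ l', p l' * (markSign M l' * groverCoeff p (markSign M) r l')) =
        (-1) ^ r * (b * Real.cos θ - a * Real.sin θ) := by
      have : ∀ l', p l' * (markSign M l' * groverCoeff p (markSign M) r l') =
          (-1) ^ r * (b / Real.cos θ) * (if M l' then 0 else p l' ^ 2) -
          (-1) ^ r * (a / Real.sin θ) * (if M l' then p l' ^ 2 else 0) := by
        intro l'
        rw [ih l', markSign]
        split_ifs <;> ring
      rw [Finset.sum_congr rfl fun l' _ => this l', Finset.sum_sub_distrib, ← Finset.mul_sum,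
        ← Finset.mul_sum, hM, hM']
      field_simp
    have e : (2 * ((r + 1 : ℕ) : ℝ) + 1) * θ = (2 * r + 1) * θ + 2 * θ := by push_cast; ring
    rw [groverCoeff]
    beta_reduce
    rw [hsum, ih l, markSign, e, Real.sin_add, Real.cos_add, ← ha, ← hb,
      Real.sin_two_mul, Real.cos_two_mul']
    have h1 := Real.sin_sq_add_cos_sq θ
    split_ifs
    · field_simp
      linear_combination ((-1) ^ r * p l * a) * h1
    · field_simp
      linear_combination (-(-1) ^ r * p l * b) * h1

theorem sum_not_marked_groverCoeff_sq {p : Λ → ℝ} (M : Λ → Prop) [DecidablePred M] {θ : ℝ}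
    (hp : ∑ l, p l ^ 2 = 1) (hM : (∑ l, if M l then p l ^ 2 else 0) = Real.sin θ ^ 2)
    (hs : Real.sin θ ≠ 0) (hc : Real.cos θ ≠ 0) (r : ℕ) :
    (∑ l, if M l then 0 else groverCoeff p (markSign M) r l ^ 2) =
      Real.cos ((2 * r + 1) * θ) ^ 2 := by
  have hM' := sum_not_marked_sq M hp hM
  have : ∀ l, (if M l then 0 else groverCoeff p (markSign M) r l ^ 2) =
      (Real.cos ((2 * r + 1) * θ) / Real.cos θ) ^ 2 * (if M l then 0 else p l ^ 2) := by
    intro l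
    rw [groverCoeff_eq M hp hM hs hc r l]
    have h1 : ((-1 : ℝ) ^ r) ^ 2 = 1 := by rw [← pow_mul, mul_comm, pow_mul]; simp
    split_ifs
    · simp
    · rw [mul_pow, mul_pow, h1, one_mul]
  rw [Finset.sum_congr rfl fun l _ => this l, ← Finset.mul_sum, hM']
  field_simp

end Grover

section Search

variable {Q : Type} [Fintype Q] [DecidableEq Q] {d : Q → ℕ}
variable {Λ : Type} [Fintype Λ]

/-- Grover search over an indirection table. The label `l` is looked up in two queries: `J l` is read
at the location in the states `A l _`, then the bit `X (J l)` at the location in the states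
`B l (J l) _`. Labels which are active and have the bit `0` are marked. An iteration takes four
queries: two to compute the bit, and two to erase the bit and the index again. The two last queries
compute the bit of the label that is measured, which is the basis of the output; the output is
therefore never `true` when all bits are `1`, whatever the amplitudes are. -/
theorem exists_searchSubroutine {n : ℕ} [NeZero n] (w : ℕ) (start : QueryBasis d w)
    (A : Λ → Fin n → QueryBasis d w) (B : Λ → Fin n → Fin 2 → QueryBasis d w)
    (hA : Function.Injective fun y : Λ × Fin n => A y.1 y.2)
    (hB : Function.Injective fun y : Λ × Fin n × Fin 2 => B y.1 y.2.1 y.2.2)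
    (active : Λ → Bool) (p : Λ → ℝ) (hp : ∑ l, p l ^ 2 = 1) (m : ℕ) :
    ∃ S : QuerySubroutine d, S.queries = 4 * m + 2 ∧
      ∀ (z : ∀ q, Fin (d q)) (J : Λ → Fin n) (X : Fin n → Fin 2),
        (∀ l j, oracleMap w z (A l j) = A l (j + J l)) →
        (∀ l j b, oracleMap w z (B l j b) = B l j (b + X j)) →
        ∀ b, S.outProb z b = ∑ l, if decide (X (J l) = 0) = b then
          groverCoeff p (markSign fun l => active l = true ∧ X (J l) = 0) m l ^ 2 else 0 := by
  classical
  have hB0 : Function.Injective fun y : Λ × Fin n => B y.1 y.2 0 := by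
    rintro ⟨l, j⟩ ⟨l', j'⟩ h
    simpa using @hB (l, j, 0) (l', j', 0) h
  have hAneg : Function.Injective fun y : Λ × Fin n => A y.1 (-y.2) := by
    rintro ⟨l, j⟩ ⟨l', j'⟩ h
    simpa using @hA (l, -j) (l', -j') h
  have hBiff : ∀ l j b l' j' b', B l j b = B l' j' b' ↔ l = l' ∧ j = j' ∧ b = b' := by
    intro l j b l' j' b'
    simpa using hB.eq_iff (a := (l, j, b)) (b := (l', j', b'))
  -- `σ` moves the index that was read into the query register. `τ` moves it back and negates it,
  -- so that the next query erases it.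
  obtain ⟨σ, hσ⟩ := exists_perm_extending _ _ hA hB0
  obtain ⟨τ, hτ⟩ := exists_perm_extending _ _ hB0 hAneg
  replace hσ : ∀ l j, σ (A l j) = B l j 0 := fun l j => hσ (l, j)
  replace hτ : ∀ l j, τ (B l j 0) = A l (-j) := fun l j => hτ (l, j)
  have hA0 : Function.Injective fun l => A l 0 := by
    intro l l' h
    simpa using @hA (l, 0) (l', 0) h
  let ψ : QueryBasis d w → ℝ := ∑ l, p l • Pi.single (A l 0) (1 : ℝ)
  have hψ : ψ ⬝ᵥ ψ = 1 := by
    simp only [ψ]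
    rw [real_superposition_dotProduct hA0, ← hp]
    exact Finset.sum_congr rfl fun l _ => by ring
  -- The states that get the phase `-1`, recognised while the bit is in the answer register.
  let P : Set (QueryBasis d w) := {s | ∃ l j, active l = true ∧ s = B l j 0}
  let S : QuerySubroutine d :=
    { work := w
      queries := 4 * m + 2
      start := start
      gate := fun i =>
        if i = 0 then reflectionGate (Pi.single start 1 - ψ)
        else if i % 4 = 0 then reflectionGate ψ
        else if i % 4 = 1 then permGate σ
        else if i % 4 = 2 then phaseGate P
        else permGate τ
      out := fun s => decide (∃ l j, s = B l j 0) }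
  refine ⟨S, rfl, fun z J X hzA hzB b => ?_⟩
  set M : Λ → Prop := fun l => active l = true ∧ X (J l) = 0 with hM
  set c := groverCoeff p (markSign M) with hc
  -- A second query erases the bit, since the alphabet has size `2`.
  have hadd : ∀ x : Fin 2, x + x = 0 := by decide
  have h0 : S.state z 0 = superposition (fun l => A l 0) (c 0) := by
    have : (Pi.single start 1 : QueryBasis d w → ℂ) = toComplex (Pi.single start (1 : ℝ)) := by
      ext s
      simp [toComplex, Pi.single_apply, apply_ite]
    change (reflectionGate (Pi.single start 1 - ψ)).1.mulVec (Pi.single start 1) = _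
    rw [this, reflectionGate_sub_mulVec (by rw [hψ]; simp), superposition_eq_toComplex]
    rfl
  have h1 : ∀ r, S.state z (4 * r) = superposition (fun l => A l 0) (c r) →
      S.state z (4 * r + 1) = superposition (fun l => B l (J l) 0) (c r) := by
    intro r h
    have hg : S.gate (4 * r + 1) = permGate σ := by simp [S]
    rw [QuerySubroutine.state, hg, h,
      mulVec_superposition_of_map (M := oracleMatrix S.work z) (e' := fun l => A l (J l))]
    · exact mulVec_superposition_of_map _ fun l => by rw [permGate_mulVec_single, hσ]
    · intro l
      rw [oracleMatrix_mulVec_single, hzA, zero_add]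
  have h2 : ∀ r, S.state z (4 * r + 1) = superposition (fun l => B l (J l) 0) (c r) →
      S.state z (4 * r + 2) =
        superposition (fun l => B l (J l) (X (J l))) (fun l => markSign M l * c r l) := by
    intro r h
    have hg : S.gate (4 * r + 2) = phaseGate P := by simp [S]
    rw [QuerySubroutine.state, hg, h, mulVec_superposition_of_map (M := oracleMatrix S.work z)
      (e' := fun l => B l (J l) (X (J l)))]
    · refine mulVec_superposition _ fun l => ?_
      rw [phaseGate_mulVec_single]
      have : B l (J l) (X (J l)) ∈ P ↔ M l := by
        simp only [P, Set.mem_ofPred_eq, hBiff, hM]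
        constructor
        · rintro ⟨l', j', ha, rfl, _, hx⟩
          exact ⟨ha, hx⟩
        · rintro ⟨ha, hx⟩
          exact ⟨l, J l, ha, rfl, rfl, hx⟩
      simp only [this, markSign]
    · intro l
      rw [oracleMatrix_mulVec_single, hzB, zero_add]
  have h3 : ∀ r, S.state z (4 * r + 2) =
        superposition (fun l => B l (J l) (X (J l))) (fun l => markSign M l * c r l) →
      S.state z (4 * r + 3) =
        superposition (fun l => A l (-J l)) (fun l => markSign M l * c r l) := by
    intro r h
    have hg : S.gate (4 * r + 3) = permGate τ := by simp [S]
    rw [QuerySubroutine.state, hg, h, mulVec_superposition_of_map (M := oracleMatrix S.work z)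
      (e' := fun l => B l (J l) 0)]
    · exact mulVec_superposition_of_map _ fun l => by rw [permGate_mulVec_single, hτ]
    · intro l
      rw [oracleMatrix_mulVec_single, hzB, hadd]
  have h4 : ∀ r, S.state z (4 * r + 3) =
        superposition (fun l => A l (-J l)) (fun l => markSign M l * c r l) →
      S.state z (4 * (r + 1)) = superposition (fun l => A l 0) (c (r + 1)) := by
    intro r h
    have hg : S.gate (4 * r + 3 + 1) = reflectionGate ψ := by
      simp [S, show 4 * r + 3 + 1 = 4 * (r + 1) by ring]
    rw [show 4 * (r + 1) = 4 * r + 3 + 1 by ring, QuerySubroutine.state, hg, h,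
      mulVec_superposition_of_map (M := oracleMatrix S.work z) (e' := fun l => A l 0)]
    · change (householder ψ).mulVec _ = _
      rw [superposition_eq_toComplex, householder_mulVec, superposition_eq_toComplex, hψ]
      congr 1
      simp only [ψ]
      rw [real_superposition_dotProduct hA0, div_one, Finset.smul_sum, ← Finset.sum_sub_distrib]
      refine Finset.sum_congr rfl fun l _ => ?_
      rw [smul_smul, ← sub_smul]
      rfl
    · intro l
      rw [oracleMatrix_mulVec_single, hzA, neg_add_cancel]
  have hstate : ∀ r, S.state z (4 * r) = superposition (fun l => A l 0) (c r) := by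
    intro r
    induction r with
    | zero => exact h0
    | succ r ih => exact h4 r (h3 r (h2 r (h1 r ih)))
  have hfin := h2 m (h1 m (hstate m))
  have hinj : Function.Injective fun l => B l (J l) (X (J l)) := by
    intro l l' h
    exact ((hBiff _ _ _ _ _ _).1 h).1
  change (∑ s, if S.out s = b then ‖S.state z (4 * m + 2) s‖ ^ 2 else 0) = _
  rw [hfin, sum_superposition hinj]
  refine Finset.sum_congr rfl fun l _ => ?_
  have ho : S.out (B l (J l) (X (J l))) = decide (X (J l) = 0) := by
    simp only [S, hBiff]
    congr 1
    apply propext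
    constructor
    · rintro ⟨l', j', _, _, hx⟩
      exact hx
    · intro hx
      exact ⟨l, J l, rfl, rfl, hx⟩
  have hsq : (markSign M l * c m l) ^ 2 = c m l ^ 2 := by
    rw [mul_pow, markSign]
    split_ifs <;> simp
  rw [ho, hsq]

end Search

/-! ### Searching for a false variable of a conjunction -/

/-- A marked weight at most twice the expected one enlarges the Grover angle by a factor of at
most `3 / 2`. -/
theorem two_mul_sin_sq_le_sin_sq {θ : ℝ} (h0 : 0 ≤ θ) (h1 : θ ≤ 1 / 3) :
    2 * Real.sin θ ^ 2 ≤ Real.sin (3 / 2 * θ) ^ 2 := by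
  have e1 : Real.sin θ = 2 * Real.sin (θ / 2) * Real.cos (θ / 2) := by
    rw [← Real.sin_two_mul]; congr 1; ring
  have e2 : Real.sin (3 / 2 * θ) = 3 * Real.sin (θ / 2) - 4 * Real.sin (θ / 2) ^ 3 := by
    rw [← Real.sin_three_mul]; congr 1; ring
  have hle : Real.sin (θ / 2) ≤ 1 / 6 := (Real.sin_le (by linarith)).trans (by linarith)
  have hnn : 0 ≤ Real.sin (θ / 2) :=
    Real.sin_nonneg_of_nonneg_of_le_pi (by linarith) (by linarith [Real.pi_gt_three])
  have hcs : Real.cos (θ / 2) ^ 2 = 1 - Real.sin (θ / 2) ^ 2 := by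
    linarith [Real.sin_sq_add_cos_sq (θ / 2)]
  rw [e1, e2]
  set s := Real.sin (θ / 2)
  have hs : s ^ 2 ≤ 1 / 36 := by nlinarith
  have : (3 * s - 4 * s ^ 3) ^ 2 - 2 * (2 * s * Real.cos (θ / 2)) ^ 2 =
      s ^ 2 * (16 * (s ^ 2) ^ 2 + (1 - 16 * s ^ 2)) := by
    rw [mul_pow, mul_pow, hcs]; ring
  have : 0 ≤ s ^ 2 * (16 * (s ^ 2) ^ 2 + (1 - 16 * s ^ 2)) := by
    have : 0 ≤ 1 - 16 * s ^ 2 := by linarith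
    positivity
  linarith

/-- Let `m` iterations be exact for the angle `φ = π / (2 (2 m + 1))`. If the marked weight `y` lies
between `sin² φ` and `2 sin² φ`, then `m` iterations turn the state by an angle between `π / 2` and
`3 π / 4`, so that they miss with probability at most `1 / 2`. -/
theorem exists_angle {m : ℕ} (hm : 2 ≤ m) {y : ℝ} (hy0 : 0 ≤ y)
    (hy1 : Real.sin (Real.pi / (2 * (2 * m + 1))) ^ 2 ≤ y)
    (hy2 : y ≤ 2 * Real.sin (Real.pi / (2 * (2 * m + 1))) ^ 2) :
    ∃ θ : ℝ, Real.sin θ ^ 2 = y ∧ Real.sin θ ≠ 0 ∧ Real.cos θ ≠ 0 ∧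
      Real.cos ((2 * m + 1) * θ) ^ 2 ≤ 1 / 2 ∧
      (y = Real.sin (Real.pi / (2 * (2 * m + 1))) ^ 2 → Real.cos ((2 * m + 1) * θ) = 0) := by
  set φ := Real.pi / (2 * (2 * m + 1)) with hφ
  have hm' : (2 : ℝ) ≤ m := by exact_mod_cast hm
  have hpi := Real.pi_gt_three
  have hpi' := Real.pi_lt_d2
  have hφm : (2 * m + 1) * φ = Real.pi / 2 := by rw [hφ]; field_simp
  have hφ0 : 0 < φ := by positivity
  have hφ1 : φ ≤ 1 / 3 := by
    rw [hφ, div_le_div_iff₀ (by positivity) (by norm_num)]; linarith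
  have hsφ : 0 < Real.sin φ := Real.sin_pos_of_pos_of_lt_pi hφ0 (by linarith)
  have hs32 : 0 ≤ Real.sin (3 / 2 * φ) :=
    Real.sin_nonneg_of_nonneg_of_le_pi (by linarith) (by linarith)
  have hr1 : Real.sin φ ≤ √y := Real.le_sqrt_of_sq_le hy1
  have hr2 : √y ≤ Real.sin (3 / 2 * φ) := by
    rw [Real.sqrt_le_left hs32]
    exact hy2.trans (two_mul_sin_sq_le_sin_sq hφ0.le hφ1)
  have hsin : Real.sin (Real.arcsin √y) = √y :=
    Real.sin_arcsin (by linarith [Real.sqrt_nonneg y]) (hr2.trans (Real.sin_le_one _))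
  have hθ1 : φ ≤ Real.arcsin √y := by
    rw [Real.le_arcsin_iff_sin_le' ⟨by linarith, by linarith⟩]
    exact hr1
  have hθ2 : Real.arcsin √y ≤ 3 / 2 * φ := by
    rw [Real.arcsin_le_iff_le_sin' ⟨by linarith, by linarith⟩]
    exact hr2
  refine ⟨Real.arcsin √y, ?_, ?_, ?_, ?_, ?_⟩
  · rw [hsin, Real.sq_sqrt hy0]
  · rw [hsin]; linarith
  · exact (Real.cos_pos_of_mem_Ioo ⟨by linarith, by linarith⟩).ne'
  · have h : Real.cos (2 * ((2 * m + 1) * Real.arcsin √y)) ≤ 0 := by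
      have a1 : (2 * (m : ℝ) + 1) * φ ≤ (2 * m + 1) * Real.arcsin √y := by gcongr
      have a2 : (2 * (m : ℝ) + 1) * Real.arcsin √y ≤ (2 * m + 1) * (3 / 2 * φ) := by gcongr
      exact Real.cos_nonpos_of_pi_div_two_le_of_le (by linarith) (by linarith)
    rw [Real.cos_sq]
    linarith
  · intro h
    rw [h, Real.sqrt_sq hsφ.le, Real.arcsin_sin (by linarith) (by linarith), hφm,
      Real.cos_pi_div_two]

theorem bitVal_eq_zero_iff (b : Bool) : bitVal b = 0 ↔ b = false := by
  cases b <;> simp [bitVal]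

namespace ZhegalkinPoly

variable {n k : ℕ} {t : Fin k → ℕ}

/-- The number of positions of the conjunction `C_i` that hold a false variable. -/
def falseCount (P : ZhegalkinPoly n k t) (i : Fin k) (x : Fin n → Bool) : ℕ :=
  (Finset.univ.filter fun z : Fin (t i) => x (P.idx i z) = false).card

/-- A search for a false variable in the conjunction `C_i`, tuned to the guess that `g` positions
hold one. It never reports a false variable when there is none; it surely finds one if the guess is
right, and with probability at least `1 / 2` if the true number is between `g` and `2 * g`. -/
theorem exists_conjSearch (n k : ℕ) (t : Fin k → ℕ) (mem : ℕ) (i : Fin k) {g : ℕ} (hg : 1 ≤ g)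
    (hgt : g ≤ t i) :
    ∃ S : QuerySubroutine (withMemory (locSize n k t) mem),
      (S.queries : ℝ) ≤ 14 * √((t i : ℝ) / g) ∧
      ∀ (P : ZhegalkinPoly n k t) (x : Fin n → Bool) (μ : Fin mem → Bool),
        (P.conj i x = true → S.outProb (joinMemory (P.input x) μ) true = 0) ∧
        (g ≤ P.falseCount i x → P.falseCount i x ≤ 2 * g →
          S.outProb (joinMemory (P.input x) μ) false ≤ 1 / 2) ∧
        (P.falseCount i x = g → S.outProb (joinMemory (P.input x) μ) false = 0) := by
  obtain rfl | hn := Nat.eq_zero_or_pos n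
  -- Without variables there is no polynomial with a nonempty conjunction.
  · refine ⟨⟨1, 0, (⟨Sum.inl (Sum.inl ()), (0 : Fin 2)⟩, 0), fun _ => 1, fun _ => false⟩, ?_,
      fun P => (P.idx i ⟨0, by omega⟩).elim0⟩
    simp only [Nat.cast_zero]
    positivity
  have : NeZero n := ⟨by omega⟩
  set N := t i with hN
  set m := ⌈√((N : ℝ) / g)⌉₊ + 1 with hm
  have hgpos : (0 : ℝ) < g := by exact_mod_cast hg
  have hgN : (g : ℝ) ≤ N := by exact_mod_cast hgt
  have hNpos : (0 : ℝ) < N := hgpos.trans_le hgN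
  have hratio : 1 ≤ √((N : ℝ) / g) := by
    rw [Real.one_le_sqrt, le_div_iff₀ hgpos]; linarith
  have hm2 : 2 ≤ m := by
    have : 0 < ⌈√((N : ℝ) / g)⌉₊ := Nat.ceil_pos.2 (by linarith)
    omega
  have hm2' : (2 : ℝ) ≤ m := by exact_mod_cast hm2
  have hmlow : √((N : ℝ) / g) ≤ m := by
    rw [hm]; push_cast; linarith [Nat.le_ceil √((N : ℝ) / g)]
  have hmup : (m : ℝ) ≤ √((N : ℝ) / g) + 2 := by
    rw [hm]; push_cast; linarith [Nat.ceil_lt_add_one (Real.sqrt_nonneg ((N : ℝ) / g))]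
  set φ := Real.pi / (2 * (2 * m + 1)) with hφ
  have hφ0 : 0 ≤ φ := by positivity
  have hφ1 : φ ≤ 1 / m := by
    rw [hφ, div_le_div_iff₀ (by positivity) (by positivity)]
    nlinarith [Real.pi_lt_d2]
  have hsφ : Real.sin φ ^ 2 / g ≤ 1 / N := by
    have h1 : Real.sin φ ≤ 1 / √((N : ℝ) / g) :=
      (Real.sin_le hφ0).trans (hφ1.trans (by gcongr))
    have h0 : 0 ≤ Real.sin φ := Real.sin_nonneg_of_nonneg_of_le_pi hφ0 (by
      have : (1 : ℝ) / m ≤ 1 := by rw [div_le_one (by positivity)]; linarith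
      linarith [Real.pi_gt_three])
    have h2 : Real.sin φ ^ 2 ≤ (1 / √((N : ℝ) / g)) ^ 2 := by gcongr
    rw [div_pow, Real.sq_sqrt (by positivity), one_pow] at h2
    calc Real.sin φ ^ 2 / g ≤ 1 / ((N : ℝ) / g) / g := by gcongr
      _ = 1 / N := by field_simp
  -- Only labels with the flag `true` can be marked. The weight of the flag is tuned so that `g` marked
  -- positions have total weight exactly `sin² φ`, and then `m` iterations reach the marked part
  -- exactly.
  let p : Fin N × Bool → ℝ := fun l =>
    if l.2 then √(Real.sin φ ^ 2 / g) else √(1 / N - Real.sin φ ^ 2 / g)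
  have hpt : ∀ z, p (z, true) ^ 2 = Real.sin φ ^ 2 / g := fun z => by
    simp only [p, if_true]
    exact Real.sq_sqrt (by positivity)
  have hpf : ∀ z, p (z, false) ^ 2 = 1 / N - Real.sin φ ^ 2 / g := fun z => by
    simp only [p, Bool.false_eq_true, if_false]
    exact Real.sq_sqrt (by linarith)
  have hp : ∑ l, p l ^ 2 = 1 := by
    rw [Fintype.sum_prod_type]
    simp only [Fintype.sum_bool, hpt, hpf, add_sub_cancel]
    simp [hNpos.ne']
  let e := Fintype.equivFin (Fin N × Bool)
  let A : Fin N × Bool → Fin n →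
      QueryBasis (withMemory (locSize n k t) mem) (Fintype.card (Fin N × Bool)) :=
    fun l j => (⟨Sum.inl (Sum.inr (Sum.inl ⟨i, l.1⟩)), j⟩, e l)
  let B : Fin N × Bool → Fin n → Fin 2 →
      QueryBasis (withMemory (locSize n k t) mem) (Fintype.card (Fin N × Bool)) :=
    fun l j b => (⟨Sum.inl (Sum.inr (Sum.inr j)), b⟩, e l)
  have hA : Function.Injective fun y : (Fin N × Bool) × Fin n => A y.1 y.2 := by
    rintro ⟨l, j⟩ ⟨l', j'⟩ h
    simp only [A, Prod.mk.injEq, EmbeddingLike.apply_eq_iff_eq] at h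
    obtain ⟨h1, rfl⟩ := h
    have h2 : j = j' := eq_of_heq (Sigma.mk.inj h1).2
    rw [h2]
  have hB : Function.Injective fun y : (Fin N × Bool) × Fin n × Fin 2 => B y.1 y.2.1 y.2.2 := by
    rintro ⟨l, j, b⟩ ⟨l', j', b'⟩ h
    simp only [B, Prod.mk.injEq, EmbeddingLike.apply_eq_iff_eq] at h
    obtain ⟨h1, rfl⟩ := h
    obtain ⟨h2, h3⟩ := Sigma.mk.inj h1
    obtain rfl : j = j' := Sum.inr.inj (Sum.inr.inj (Sum.inl.inj h2))
    have h4 : b = b' := eq_of_heq h3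
    rw [h4]
  obtain ⟨S, hSq, hS⟩ := exists_searchSubroutine (Fintype.card (Fin N × Bool))
    (A (⟨0, by omega⟩, false) 0) A B hA hB Prod.snd p hp m
  refine ⟨S, ?_, fun P x μ => ?_⟩
  · rw [hSq]
    push_cast
    linarith
  have key := hS (joinMemory (P.input x) μ) (fun l => P.idx i l.1) (fun j => bitVal (x j))
    (fun _ _ => rfl) (fun _ _ _ => rfl)
  set c := groverCoeff p (markSign fun l : Fin N × Bool =>
    l.2 = true ∧ x (P.idx i l.1) = false) m with hc
  have hcong : groverCoeff p (markSign fun l : Fin N × Bool =>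
      l.2 = true ∧ bitVal (x (P.idx i l.1)) = 0) m = c := by
    rw [hc]
    congr 1
    funext l
    simp only [markSign, bitVal_eq_zero_iff]
  simp only [hcong, bitVal_eq_zero_iff] at key
  have hle : S.outProb (joinMemory (P.input x) μ) false ≤
      ∑ l : Fin N × Bool, if l.2 = true ∧ x (P.idx i l.1) = false then 0 else c l ^ 2 := by
    rw [key]
    refine Finset.sum_le_sum fun l _ => ?_
    by_cases h : x (P.idx i l.1) = false
    · simp only [h, decide_true, Bool.true_eq_false, if_false]
      split_ifs <;> positivity
    · simp [h]
  have hM : (∑ l : Fin N × Bool, if l.2 = true ∧ x (P.idx i l.1) = false then p l ^ 2 else 0) =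
      P.falseCount i x * (Real.sin φ ^ 2 / g) := by
    rw [Fintype.sum_prod_type]
    simp only [Fintype.sum_bool, true_and, Bool.false_eq_true, false_and, if_false, add_zero, hpt]
    rw [← Finset.sum_filter, Finset.sum_const, nsmul_eq_mul, falseCount]
  have hmain : g ≤ P.falseCount i x → P.falseCount i x ≤ 2 * g →
      ∃ θ : ℝ, S.outProb (joinMemory (P.input x) μ) false ≤ Real.cos ((2 * m + 1) * θ) ^ 2 ∧
      Real.cos ((2 * m + 1) * θ) ^ 2 ≤ 1 / 2 ∧
      (P.falseCount i x = g → Real.cos ((2 * m + 1) * θ) = 0) := by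
    intro h1 h2
    have h1' : (g : ℝ) ≤ P.falseCount i x := by exact_mod_cast h1
    have h2' : (P.falseCount i x : ℝ) ≤ 2 * g := by exact_mod_cast h2
    have e0 : (P.falseCount i x : ℝ) * (Real.sin φ ^ 2 / g) =
      (P.falseCount i x / g) * Real.sin φ ^ 2 := by ring
    obtain ⟨θ, t1, t2, t3, t4, t5⟩ := exists_angle hm2
      (y := P.falseCount i x * (Real.sin φ ^ 2 / g)) (by positivity)
      (by
        rw [e0]
        exact le_mul_of_one_le_left (by positivity) ((one_le_div hgpos).2 h1'))
      (by
        rw [e0]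
        gcongr
        rwa [div_le_iff₀ hgpos])
    refine ⟨θ, hle.trans_eq (sum_not_marked_groverCoeff_sq _ hp (hM.trans t1.symm) t2 t3 m), t4,
      fun h => t5 ?_⟩
    rw [h, ← hφ]
    field_simp
  refine ⟨fun h => ?_, fun h1 h2 => ?_, fun h => ?_⟩
  · rw [key]
    have hx : ∀ z, x (P.idx i z) = true := by simpa [conj] using h
    simp [hx]
  · obtain ⟨θ, a1, a2, _⟩ := hmain h1 h2
    exact a1.trans a2
  · obtain ⟨θ, a1, _, a3⟩ := hmain h.ge (by omega)
    rw [a3 h] at a1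
    exact le_antisymm (by simpa using a1) (S.outProb_nonneg _ _)

end ZhegalkinPoly

/-! ### Classical steps and the analysis of the loop -/

theorem decide_bitVal_val_eq_one (b : Bool) : decide ((bitVal b).val = 1) = b := by
  cases b <;> simp [bitVal]

section Reading

variable {Q : Type} {d : Q → ℕ}

/-- The value at the location `q`, read as a bit. Only used where the alphabet has size `2`. -/
def bitAt (z : ∀ q, Fin (d q)) (q : Q) : Bool := decide ((z q).val = 1)

theorem bitAt_joinMemory_inr {m : ℕ} (z : ∀ q, Fin (d q)) (μ : Fin m → Bool) (c : Fin m) :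
    bitAt (joinMemory z μ) (Sum.inr c) = μ c :=
  decide_bitVal_val_eq_one (μ c)

theorem ZhegalkinPoly.bitAt_input_constant {n k m : ℕ} {t : Fin k → ℕ} (P : ZhegalkinPoly n k t)
    (x : Fin n → Bool) (μ : Fin m → Bool) :
    bitAt (joinMemory (P.input x) μ) (Sum.inl (Sum.inl ())) = P.a :=
  decide_bitVal_val_eq_one P.a

variable [Fintype Q] [DecidableEq Q]

/-- Any Boolean function of two stored or input bits can be computed without error by two queries. -/
theorem exists_readTwo {q₁ q₂ : Q} (h₁ : 0 < d q₁) (h₂ : 0 < d q₂) (f : Bool → Bool → Bool) :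
    ∃ S : QuerySubroutine d, S.queries = 2 ∧ ∀ (z : ∀ q, Fin (d q)) (b : Bool), S.outProb z b =
      if f (bitAt z q₁) (bitAt z q₂) = b then 1 else 0 := by
  -- The work register has the alphabet of `q₁`, so that it can take the first value that is read.
  let b₁ : Fin (d q₁) := ⟨0, h₁⟩
  let b₂ : Fin (d q₂) := ⟨0, h₂⟩
  let e₁ : Fin (d q₁) → QueryBasis d (d q₁) := fun b => (⟨q₁, b⟩, b₁)
  let e₂ : Fin (d q₁) → QueryBasis d (d q₁) := fun b => (⟨q₂, b₂⟩, b)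
  have he₁ : Function.Injective e₁ := fun b b' h =>
    eq_of_heq (Sigma.mk.inj (Prod.mk.inj h).1).2
  have he₂ : Function.Injective e₂ := fun b b' h => (Prod.mk.inj h).2
  obtain ⟨σ, hσ⟩ := exists_perm_extending e₁ e₂ he₁ he₂
  let S : QuerySubroutine d :=
    { work := d q₁
      queries := 2
      start := e₁ b₁
      gate := fun i => if i = 1 then permGate σ else 1
      out := fun s => f (decide (s.2.val = 1)) (decide (s.1.2.val = 1)) }
  refine ⟨S, rfl, fun z b => ?_⟩
  have hzero : ∀ (n : ℕ) (h : 0 < n) (y : Fin n), (⟨0, h⟩ : Fin n) + y = y := by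
    intro n h y
    apply Fin.ext
    rw [Fin.val_add, zero_add, Nat.mod_eq_of_lt y.2]
  have s0 : S.state z 0 = Pi.single (e₁ b₁) 1 := Matrix.one_mulVec _
  have o1 : oracleMap (d q₁) z (e₁ b₁) = e₁ (z q₁) := by
    change ((⟨q₁, b₁ + z q₁⟩, b₁) : QueryBasis d (d q₁)) = (⟨q₁, z q₁⟩, b₁)
    rw [hzero]
  have o2 : oracleMap (d q₁) z (e₂ (z q₁)) = (⟨q₂, z q₂⟩, z q₁) := by
    change ((⟨q₂, b₂ + z q₂⟩, z q₁) : QueryBasis d (d q₁)) = _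
    rw [hzero]
  have s1 : S.state z 1 = Pi.single (e₂ (z q₁)) 1 := by
    change (permGate σ).1.mulVec ((oracleMatrix (d q₁) z).mulVec (S.state z 0)) = _
    rw [s0]
    erw [oracleMatrix_mulVec_single, o1]
    rw [permGate_mulVec_single, hσ]
  have s2 : S.state z 2 = Pi.single (⟨q₂, z q₂⟩, z q₁) 1 := by
    change (1 : Matrix _ _ ℂ).mulVec ((oracleMatrix (d q₁) z).mulVec (S.state z 1)) = _
    rw [s1, Matrix.one_mulVec]
    erw [oracleMatrix_mulVec_single, o2]
  change (∑ s, if S.out s = b then ‖S.state z 2 s‖ ^ 2 else 0) = _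
  rw [s2, Finset.sum_eq_single ((⟨q₂, z q₂⟩, z q₁) : QueryBasis d (d q₁))]
  · have ho : S.out (⟨q₂, z q₂⟩, z q₁) = f (bitAt z q₁) (bitAt z q₂) := rfl
    rw [Pi.single_eq_same, ho, norm_one, one_pow]
  · intro s _ hs
    rw [Pi.single_eq_of_ne hs]
    simp
  · simp

end Reading

namespace QuantumAlgorithm

variable {Q : Type} [Fintype Q] [DecidableEq Q] {d : Q → ℕ} {m : ℕ}

theorem runProb_cons_of_deterministic {z : ∀ q, Fin (d q)} {r : Fin m} {b : Bool}
    {S : QuerySubroutine (withMemory d m)} {c : Fin m}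
    {l : List (QuerySubroutine (withMemory d m) × Fin m)} {μ : Fin m → Bool} {v : Bool}
    (h : ∀ v', S.outProb (joinMemory z μ) v' = if v = v' then 1 else 0) :
    runProb z r b ((S, c) :: l) μ = runProb z r b l (Function.update μ c v) := by
  rw [runProb]
  simp [h]

theorem runProb_accumulate_xor {ι : Type} {z : ∀ q, Fin (d q)} {r : Fin m} {b : Bool}
    (cell : ι → Fin m) (hr : ∀ i, cell i ≠ r) (S : ι → QuerySubroutine (withMemory d m))
    (hS : ∀ i μ v, (S i).outProb (joinMemory z μ) v =
      if xor (μ r) (!μ (cell i)) = v then 1 else 0) (l : List ι) (μ : Fin m → Bool) :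
    runProb z r b (l.map fun i => (S i, r)) μ =
      if (l.map fun i => !μ (cell i)).foldl xor (μ r) = b then 1 else 0 := by
  induction l generalizing μ with
  | nil => simp [runProb]
  | cons i l ih =>
    rw [List.map_cons, runProb_cons_of_deterministic (hS i μ), ih]
    simp [Function.update_of_ne (hr _)]

section Loop

variable {k : ℕ}

/-- Run the searches `S j` for the jobs `j` one after the other. The result of each goes to the cell
`tmp`, and `O (idx j)` then adds it to the cell of the conjunction `idx j` by a disjunction. -/
def orSteps {ι : Type} (S : ι → QuerySubroutine (withMemory d m))
    (O : Fin k → QuerySubroutine (withMemory d m)) (tmp : Fin m) (cell : Fin k → Fin m)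
    (idx : ι → Fin k) (jobs : List ι) : List (QuerySubroutine (withMemory d m) × Fin m) :=
  jobs.flatMap fun j => [(S j, tmp), (O (idx j), cell (idx j))]

/-- A bound for the probability that, after the remaining `jobs`, the cell of the conjunction `i`,
which now holds `found`, does not hold the negation of `C i`. It is the potential function for the
analysis of the loop. -/
noncomputable def wrongBound {ι : Type} (idx : ι → Fin k) (C : Fin k → Bool) (fail : ι → ℝ)
    (jobs : List ι) (i : Fin k) (found : Bool) : ℝ :=
  if C i = true then (if found = true then 1 else 0)
  else if found = true then 0 else (jobs.map fun j => if idx j = i then fail j else 1).prod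

theorem wrongBound_nil {ι : Type} (idx : ι → Fin k) (C : Fin k → Bool) (fail : ι → ℝ)
    (i : Fin k) (found : Bool) :
    wrongBound idx C fail [] i found = if found = !C i then 0 else 1 := by
  unfold wrongBound
  cases C i <;> cases found <;> simp

/-- If the error probability of the steps `last` is at most the number of cells that hold a wrong
bit, then the error probability of the whole loop is at most the sum of the potentials: a step does
not increase the expected potential. -/
theorem runProb_orSteps_le {ι : Type} {z : ∀ q, Fin (d q)} {r tmp : Fin m} {b : Bool}
    {cell : Fin k → Fin m} (hcell : Function.Injective cell) (htmp : ∀ i, cell i ≠ tmp)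
    {S : ι → QuerySubroutine (withMemory d m)} {O : Fin k → QuerySubroutine (withMemory d m)}
    (hO : ∀ i μ v, (O i).outProb (joinMemory z μ) v =
      if (μ tmp || μ (cell i)) = v then 1 else 0)
    {idx : ι → Fin k} {C : Fin k → Bool} {fail : ι → ℝ}
    (hfail0 : ∀ j, 0 ≤ fail j)
    {last : List (QuerySubroutine (withMemory d m) × Fin m)}
    (hlast : ∀ μ : Fin m → Bool,
      runProb z r b last μ ≤ ∑ i, wrongBound idx C fail [] i (μ (cell i)))
    (jobs : List ι)
    (hsound : ∀ j ∈ jobs, C (idx j) = true → ∀ μ, (S j).outProb (joinMemory z μ) true = 0)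
    (hfail : ∀ j ∈ jobs, ∀ μ, (S j).outProb (joinMemory z μ) false ≤ fail j)
    (μ : Fin m → Bool) :
    runProb z r b (orSteps S O tmp cell idx jobs ++ last) μ ≤
      ∑ i, wrongBound idx C fail jobs i (μ (cell i)) := by
  induction jobs generalizing μ with
  | nil => exact hlast μ
  | cons j jobs ih =>
    have ih := ih (fun j' h => hsound j' (List.mem_cons_of_mem _ h))
      (fun j' h => hfail j' (List.mem_cons_of_mem _ h))
    have hs := hsound j List.mem_cons_self
    have hf := hfail j List.mem_cons_self μ
    set p := (S j).outProb (joinMemory z μ) with hp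
    have h1 : p true + p false = 1 := (S j).outProb_true_add_false _
    have hstep : runProb z r b (orSteps S O tmp cell idx (j :: jobs) ++ last) μ =
        ∑ v : Bool, p v * runProb z r b (orSteps S O tmp cell idx jobs ++ last)
          (Function.update (Function.update μ tmp v) (cell (idx j)) (v || μ (cell (idx j)))) := by
      rw [orSteps, List.flatMap_cons, List.append_assoc]
      change runProb z r b ((S j, tmp) :: (O (idx j), cell (idx j)) :: _) μ = _
      rw [runProb]
      refine Finset.sum_congr rfl fun v _ => ?_
      rw [runProb_cons_of_deterministic (hO _ _)]
      simp [Function.update_of_ne (htmp _), orSteps, hp]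
    rw [hstep]
    calc _ ≤ ∑ v : Bool, p v * ∑ i, wrongBound idx C fail jobs i
          (Function.update (Function.update μ tmp v) (cell (idx j))
            (v || μ (cell (idx j))) (cell i)) :=
          Finset.sum_le_sum fun v _ =>
            mul_le_mul_of_nonneg_left (ih _) ((S j).outProb_nonneg _ _)
      _ = ∑ i, ∑ v : Bool, p v * wrongBound idx C fail jobs i
          (Function.update (Function.update μ tmp v) (cell (idx j))
            (v || μ (cell (idx j))) (cell i)) := by
          simp only [Finset.mul_sum]
          exact Finset.sum_comm
      _ ≤ _ := by
          refine Finset.sum_le_sum fun i _ => ?_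
          have hprod : 0 ≤ (jobs.map fun j' => if idx j' = i then fail j' else 1).prod := by
            apply List.prod_nonneg
            intro y hy
            obtain ⟨j', _, rfl⟩ := List.mem_map.1 hy
            split_ifs
            exacts [hfail0 j', zero_le_one]
          rw [Fintype.sum_bool]
          by_cases hi : i = idx j
          · subst hi
            simp only [Function.update_self, Bool.true_or, Bool.false_or]
            by_cases hC : C (idx j) = true
            · have : p true = 0 := hs hC μ
              have h0 : p false = 1 := by linarith
              rw [this, h0, zero_mul, zero_add, one_mul]
              simp [wrongBound, hC]
            · by_cases hb : μ (cell (idx j)) = true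
              · simp [wrongBound, hC, hb]
              · simp only [wrongBound, hC, hb, if_false, if_true, mul_zero, zero_add,
                  List.map_cons, List.prod_cons, Bool.false_eq_true]
                exact mul_le_mul_of_nonneg_right hf hprod
          · have hne : cell i ≠ cell (idx j) := fun h => hi (hcell h)
            have hi' : ¬ idx j = i := fun h => hi h.symm
            rw [Function.update_of_ne hne, Function.update_of_ne (htmp i),
              Function.update_of_ne hne, Function.update_of_ne (htmp i), ← add_mul, h1, one_mul]
            simp [wrongBound, hi']

end Loop

end QuantumAlgorithm

/-! ### The schedule of guesses -/

/-- The guesses for the number of false variables among `N` positions: `1, …, min L N`, once each,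
and the numbers `L * 2 ^ e ≤ N`, each `L` times. -/
def guesses (N L : ℕ) : List ℕ :=
  (List.range (min L N)).map (· + 1) ++
    (List.range N).flatMap fun e => if L * 2 ^ e ≤ N then List.replicate L (L * 2 ^ e) else []

theorem one_le_and_le_of_mem_guesses {N L g : ℕ} (h : g ∈ guesses N L) : 1 ≤ g ∧ g ≤ N := by
  rw [guesses, List.mem_append] at h
  obtain h | h := h
  · simp only [List.mem_map, List.mem_range] at h
    omega
  · obtain ⟨e, _, h⟩ := List.mem_flatMap.1 h
    split_ifs at h with hle
    · obtain ⟨hL, rfl⟩ := List.mem_replicate.1 h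
      exact ⟨Nat.mul_pos (Nat.pos_of_ne_zero hL) (by positivity), hle⟩
    · simp at h

theorem prod_map_nonneg {β : Type} {f : β → ℝ} (hf0 : ∀ y, 0 ≤ f y) (l : List β) :
    0 ≤ (l.map f).prod := by
  apply List.prod_nonneg
  intro y hy
  obtain ⟨x, _, rfl⟩ := List.mem_map.1 hy
  exact hf0 x

theorem prod_map_le_one {β : Type} {f : β → ℝ} (hf0 : ∀ y, 0 ≤ f y) (hf1 : ∀ y, f y ≤ 1)
    (l : List β) : (l.map f).prod ≤ 1 := by
  induction l with
  | nil => simp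
  | cons x l ih =>
    rw [List.map_cons, List.prod_cons]
    exact mul_le_one₀ (hf1 x) (prod_map_nonneg hf0 l) ih

theorem sum_map_flatMap {α β M : Type} [AddMonoid M] (f : β → M) (h : α → List β) (l : List α) :
    ((l.flatMap h).map f).sum = (l.map fun a => ((h a).map f).sum).sum := by
  induction l with
  | nil => simp
  | cons a l ih => simp [ih]

theorem prod_map_flatMap_le {α β : Type} {f : β → ℝ} (hf0 : ∀ y, 0 ≤ f y) (hf1 : ∀ y, f y ≤ 1)
    (h : α → List β) {l : List α} {a : α} (ha : a ∈ l) :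
    ((l.flatMap h).map f).prod ≤ ((h a).map f).prod := by
  have h0 := prod_map_nonneg hf0
  have h1 := prod_map_le_one hf0 hf1
  obtain ⟨l₁, l₂, rfl⟩ := List.append_of_mem ha
  rw [List.flatMap_append, List.flatMap_cons, List.map_append, List.map_append, List.prod_append,
    List.prod_append]
  exact (mul_le_of_le_one_left (mul_nonneg (h0 _) (h0 _)) (h1 _)).trans
    (mul_le_of_le_one_right (h0 _) (h1 _))

/-- A bound for the probability that the search with the guess `g` misses all of `s ≥ 1` false
variables. -/
noncomputable def missBound (s g : ℕ) : ℝ :=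
  if s = g then 0 else if g ≤ s ∧ s ≤ 2 * g then 1 / 2 else 1

theorem missBound_nonneg (s g : ℕ) : 0 ≤ missBound s g := by
  unfold missBound; split_ifs <;> norm_num

theorem missBound_le_one (s g : ℕ) : missBound s g ≤ 1 := by
  unfold missBound; split_ifs <;> norm_num

/-- All searches together miss with probability at most `2⁻ᴸ`: a number `s ≤ L` is itself a guess,
and a larger one lies between some `L * 2 ^ e` and its double. -/
theorem prod_missBound_guesses_le {N L s : ℕ} (hL : 1 ≤ L) (hs : 1 ≤ s) (hsN : s ≤ N) :
    ((guesses N L).map (missBound s)).prod ≤ (1 / 2) ^ L := by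
  by_cases hsL : s ≤ L
  · rw [List.prod_eq_zero]
    · positivity
    · refine List.mem_map.2 ⟨s, ?_, by simp [missBound]⟩
      rw [guesses, List.mem_append]
      left
      exact List.mem_map.2 ⟨s - 1, List.mem_range.2 (by omega), by omega⟩
  · set e := Nat.log 2 (s / L) with he
    have hdiv : s / L ≠ 0 := (Nat.div_pos (by omega) (by omega)).ne'
    have h1 : L * 2 ^ e ≤ s :=
      (Nat.mul_le_mul_left L (Nat.pow_log_le_self 2 hdiv)).trans (Nat.mul_div_le s L)
    have h2 : s < 2 * (L * 2 ^ e) := by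
      have : s / L < 2 ^ (e + 1) := Nat.lt_pow_succ_log_self (by norm_num) _
      rw [Nat.div_lt_iff_lt_mul (by omega)] at this
      calc s < 2 ^ (e + 1) * L := this
        _ = 2 * (L * 2 ^ e) := by ring
    have heN : e < N := by
      have : e < 2 ^ e := Nat.lt_two_pow_self
      have : 2 ^ e ≤ L * 2 ^ e := Nat.le_mul_of_pos_left _ (by omega)
      omega
    have hbig := prod_map_flatMap_le (missBound_nonneg s) (missBound_le_one s)
      (fun e => if L * 2 ^ e ≤ N then List.replicate L (L * 2 ^ e) else [])
      (List.mem_range.2 heN)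
    have hhalf : missBound s (L * 2 ^ e) ≤ 1 / 2 := by
      rw [missBound]
      split_ifs with a b
      · norm_num
      · exact le_rfl
      · exact absurd ⟨h1, h2.le⟩ b
    rw [guesses, List.map_append, List.prod_append]
    refine (mul_le_of_le_one_left (prod_map_nonneg (missBound_nonneg s) _)
      (prod_map_le_one (missBound_nonneg s) (missBound_le_one s) _)).trans (hbig.trans ?_)
    rw [if_pos (h1.trans hsN), List.map_replicate, List.prod_replicate]
    exact pow_le_pow_left₀ (missBound_nonneg _ _) hhalf L

theorem sum_inv_sqrt_le (r : ℕ) : ∑ x ∈ Finset.range r, 1 / √((x : ℝ) + 1) ≤ 2 * √r := by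
  induction r with
  | zero => simp
  | succ r ih =>
    rw [Finset.sum_range_succ]
    have h1 : √(r : ℝ) ≤ √((r : ℝ) + 1) := Real.sqrt_le_sqrt (by linarith)
    have h2 : 0 < √((r : ℝ) + 1) := Real.sqrt_pos.2 (by positivity)
    have h3 := Real.sq_sqrt (show (0 : ℝ) ≤ r by positivity)
    have h4 := Real.sq_sqrt (show (0 : ℝ) ≤ (r : ℝ) + 1 by positivity)
    have : 1 / √((r : ℝ) + 1) ≤ 2 * √((r : ℝ) + 1) - 2 * √r := by
      rw [div_le_iff₀ h2]
      nlinarith [Real.sqrt_nonneg (r : ℝ)]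
    push_cast
    linarith

theorem sum_inv_sqrt_two_pow_le (r : ℕ) : ∑ e ∈ Finset.range r, 1 / √((2 : ℝ) ^ e) ≤ 4 := by
  have h2 : √(2 : ℝ) ^ 2 = 2 := Real.sq_sqrt (by norm_num)
  have h3 : (4 / 3 : ℝ) ≤ √2 := Real.le_sqrt_of_sq_le (by norm_num)
  have key : ∑ e ∈ Finset.range r, 1 / √((2 : ℝ) ^ e) ≤ 4 - 4 / √((2 : ℝ) ^ r) := by
    induction r with
    | zero => simp
    | succ r ih =>
      rw [Finset.sum_range_succ]
      have hr : 0 < √((2 : ℝ) ^ r) := by positivity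
      have : 1 / √((2 : ℝ) ^ r) ≤ 4 / √((2 : ℝ) ^ r) - 4 / √((2 : ℝ) ^ (r + 1)) := by
        rw [pow_succ, Real.sqrt_mul (by positivity), ← sub_nonneg]
        have : 4 / √((2 : ℝ) ^ r) - 4 / (√((2 : ℝ) ^ r) * √2) - 1 / √((2 : ℝ) ^ r) =
            (3 - 4 / √2) / √((2 : ℝ) ^ r) := by
          field_simp
          ring
        rw [this]
        have : 4 / √2 ≤ (3 : ℝ) := by
          rw [div_le_iff₀ (by positivity)]; linarith
        apply div_nonneg (by linarith) hr.le
      linarith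
  have : 0 ≤ 4 / √((2 : ℝ) ^ r) := by positivity
  linarith

/-- The searches together cost `O(√(N L))` queries: the guesses up to `L` contribute
`√N · ∑ 1 / √g = O(√N √L)`, and the larger ones a geometric series. -/
theorem sum_sqrt_div_guesses_le {N L : ℕ} (hL : 1 ≤ L) :
    ((guesses N L).map fun g : ℕ => √((N : ℝ) / g)).sum ≤ 6 * √((N : ℝ) * L) := by
  have hLpos : (0 : ℝ) < L := by exact_mod_cast hL
  have hsmall : ((((List.range (min L N)).map (· + 1))).map fun g : ℕ => √((N : ℝ) / g)).sum ≤
      2 * √((N : ℝ) * L) := by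
    rw [List.map_map]
    change ∑ x ∈ Finset.range (min L N), √((N : ℝ) / ((x + 1 : ℕ) : ℝ)) ≤ _
    have h : ∀ x ∈ Finset.range (min L N), √((N : ℝ) / ((x + 1 : ℕ) : ℝ)) =
        √N * (1 / √((x : ℝ) + 1)) := fun x _ => by
      rw [Real.sqrt_div (by positivity)]
      push_cast
      ring
    rw [Finset.sum_congr rfl h, ← Finset.mul_sum, Real.sqrt_mul (by positivity)]
    have h1 := sum_inv_sqrt_le (min L N)
    have h2 : √((min L N : ℕ) : ℝ) ≤ √L := Real.sqrt_le_sqrt (by exact_mod_cast min_le_left L N)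
    calc √(N : ℝ) * ∑ x ∈ Finset.range (min L N), 1 / √((x : ℝ) + 1) ≤ √N * (2 * √L) := by
          gcongr
          linarith
      _ = 2 * (√N * √L) := by ring
  have hbig : ((((List.range N).flatMap fun e =>
      if L * 2 ^ e ≤ N then List.replicate L (L * 2 ^ e) else [])).map
        fun g : ℕ => √((N : ℝ) / g)).sum ≤ 4 * √((N : ℝ) * L) := by
    rw [sum_map_flatMap]
    change ∑ e ∈ Finset.range N, ((if L * 2 ^ e ≤ N then List.replicate L (L * 2 ^ e) else []).map
        fun g : ℕ => √((N : ℝ) / g)).sum ≤ _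
    calc _ ≤ ∑ e ∈ Finset.range N, √((N : ℝ) * L) * (1 / √((2 : ℝ) ^ e)) := by
          refine Finset.sum_le_sum fun e _ => ?_
          split_ifs
          · rw [List.map_replicate, List.sum_replicate, nsmul_eq_mul]
            push_cast
            rw [← div_div, Real.sqrt_div (by positivity), Real.sqrt_div (by positivity),
              Real.sqrt_mul (by positivity)]
            have : √(L : ℝ) * √L = L := Real.mul_self_sqrt hLpos.le
            have h0 : √(L : ℝ) ≠ 0 := (Real.sqrt_pos.2 hLpos).ne'
            apply le_of_eq
            field_simp
            linear_combination (-√(N : ℝ)) * this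
          · simp only [List.map_nil, List.sum_nil]
            positivity
      _ = √((N : ℝ) * L) * ∑ e ∈ Finset.range N, 1 / √((2 : ℝ) ^ e) := by rw [Finset.mul_sum]
      _ ≤ √((N : ℝ) * L) * 4 := by
          gcongr
          exact sum_inv_sqrt_two_pow_le N
      _ = 4 * √((N : ℝ) * L) := by ring
  rw [guesses, List.map_append, List.sum_append]
  linarith

theorem one_half_pow_two_mul_clog_le {k : ℕ} (hk : 1 ≤ k) :
    (1 / 2 : ℝ) ^ (2 * Nat.clog 2 k) ≤ 1 / (k : ℝ) ^ 2 := by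
  have h : (k : ℝ) ≤ 2 ^ Nat.clog 2 k := by exact_mod_cast Nat.le_pow_clog (by norm_num) k
  have hk' : (0 : ℝ) < k := by exact_mod_cast hk
  rw [mul_comm, pow_mul, one_div_pow, one_div_pow]
  gcongr

theorem two_mul_clog_le {k : ℕ} (hk : 2 ≤ k) : ((2 * Nat.clog 2 k : ℕ) : ℝ) ≤ 6 * Real.log k := by
  have h1 : 0 < Nat.clog 2 k := Nat.clog_pos (by norm_num) hk
  have h2 : 2 ^ (Nat.clog 2 k - 1) < k := Nat.pow_pred_clog_lt_self (by norm_num) (by omega)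
  have h2' : (2 : ℝ) ^ (Nat.clog 2 k - 1) ≤ k := by exact_mod_cast h2.le
  have h3 := Real.log_le_log (by positivity) h2'
  rw [Real.log_pow, Nat.cast_sub h1] at h3
  have h4 : Real.log 2 ≤ Real.log k := Real.log_le_log (by norm_num) (by exact_mod_cast hk)
  have h5 := Real.log_two_gt_d9
  push_cast at h3 ⊢
  nlinarith [(Nat.cast_nonneg (Nat.clog 2 k) : (0 : ℝ) ≤ _)]

/-- The arithmetic of the running time: `L = O(log k)`, and the linear term `2 * k + 2` is absorbed
as `log k` is bounded below for `k ≥ 2`. -/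
theorem cost_le {k L T : ℝ} (hk : 2 ≤ k) (hT : 0 ≤ T) (hL : L ≤ 6 * Real.log k) :
    96 * √(k * T * L) + (2 * k + 2) ≤ 300 * √(k * Real.log k * (k + T)) := by
  set R := √(k * Real.log k * (k + T)) with hR
  have hlog : (9 / 16 : ℝ) ≤ Real.log k := by
    have := Real.log_le_log (by norm_num) hk
    linarith [Real.log_two_gt_d9]
  have h1 : √(k * T * L) ≤ 5 / 2 * R := by
    rw [Real.sqrt_le_left (by positivity), mul_pow, hR, Real.sq_sqrt (by positivity)]
    have a : k * T * L ≤ k * T * (6 * Real.log k) := by gcongr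
    have b : 0 ≤ k * Real.log k * T := by positivity
    have c : 0 ≤ k * Real.log k * k := by positivity
    linarith
  have h2 : 3 / 4 * k ≤ R := by
    apply Real.le_sqrt_of_sq_le
    have a : k * (9 / 16) * k ≤ k * Real.log k * (k + T) := by
      gcongr
      linarith
    linarith
  linarith

theorem sum_sqrt_mul_le {k : ℕ} (t : Fin k → ℕ) (L : ℕ) :
    ∑ i, √((t i : ℝ) * L) ≤ √((k : ℝ) * (∑ i, (t i : ℝ)) * L) := by
  apply Real.le_sqrt_of_sq_le
  have h := sq_sum_le_card_mul_sum_sq (s := Finset.univ) (f := fun i => √((t i : ℝ) * L))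
  refine h.trans_eq ?_
  have : ∀ i, √((t i : ℝ) * L) ^ 2 = t i * L := fun i => Real.sq_sqrt (by positivity)
  simp only [this, ← Finset.sum_mul, Finset.card_univ, Fintype.card_fin]
  ring

/-! ### The algorithm -/

open QuantumAlgorithm in
/-- The algorithm for `k ≥ 2`, with error probability at most `1 / k`. -/
theorem ZhegalkinPoly.exists_algorithm {n k : ℕ} (t : Fin k → ℕ) (hk : 2 ≤ k) :
    ∃ A : QuantumAlgorithm (ZhegalkinPoly.locSize n k t),
      (A.runningTime : ℝ) ≤
          300 * √((k : ℝ) * Real.log (k : ℝ) * ((k : ℝ) + ∑ i, (t i : ℝ))) ∧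
      ∀ (P : ZhegalkinPoly n k t) (x : Fin n → Bool),
        A.errorProb (P.input x) (P.eval x) ≤ 1 / (k : ℝ) := by
  classical
  set L := 2 * Nat.clog 2 k with hL
  have hL1 : 1 ≤ L := by
    have := Nat.clog_pos (b := 2) (by norm_num) hk
    omega
  -- The cell of the conjunction `C_i` records whether a false variable of `C_i` has been found.
  let cell : Fin k → Fin (k + 2) := Fin.castAdd 2
  let tmp : Fin (k + 2) := Fin.natAdd k 0
  let res : Fin (k + 2) := Fin.natAdd k 1
  have hcell : Function.Injective cell := Fin.castAdd_injective k 2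
  have htmp : ∀ i, cell i ≠ tmp := fun i h => by
    have := congrArg Fin.val h
    simp [cell, tmp] at this
    omega
  have hres : ∀ i, cell i ≠ res := fun i h => by
    have := congrArg Fin.val h
    simp [cell, res] at this
    omega
  have hsearch : ∀ j : Fin k × ℕ, ∃ S : QuerySubroutine (withMemory (locSize n k t) (k + 2)),
      1 ≤ j.2 → j.2 ≤ t j.1 → (S.queries : ℝ) ≤ 14 * √((t j.1 : ℝ) / j.2) ∧
      ∀ (P : ZhegalkinPoly n k t) (x : Fin n → Bool) (μ : Fin (k + 2) → Bool),
        (P.conj j.1 x = true → S.outProb (joinMemory (P.input x) μ) true = 0) ∧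
        (j.2 ≤ P.falseCount j.1 x → P.falseCount j.1 x ≤ 2 * j.2 →
          S.outProb (joinMemory (P.input x) μ) false ≤ 1 / 2) ∧
        (P.falseCount j.1 x = j.2 → S.outProb (joinMemory (P.input x) μ) false = 0) := by
    intro j
    by_cases h : 1 ≤ j.2 ∧ j.2 ≤ t j.1
    · obtain ⟨S, hS⟩ := exists_conjSearch n k t (k + 2) j.1 h.1 h.2
      exact ⟨S, fun _ _ => hS⟩
    -- A job outside this range never occurs.
    · exact ⟨⟨1, 0, (⟨Sum.inl (Sum.inl ()), (0 : Fin 2)⟩, 0), fun _ => 1, fun _ => false⟩,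
        fun h1 h2 => absurd ⟨h1, h2⟩ h⟩
  choose S hS using hsearch
  have hread : ∀ (q₁ q₂ : Loc n k t ⊕ Fin (k + 2))
      (_ : 0 < withMemory (locSize n k t) (k + 2) q₁)
      (_ : 0 < withMemory (locSize n k t) (k + 2) q₂) (f : Bool → Bool → Bool), _ :=
    fun q₁ q₂ h₁ h₂ f => exists_readTwo (d := withMemory (locSize n k t) (k + 2)) h₁ h₂ f
  choose O hOq hO using fun i => hread (Sum.inr tmp) (Sum.inr (cell i)) Nat.two_pos Nat.two_pos or
  choose X hXq hX using fun i => hread (Sum.inr res) (Sum.inr (cell i)) Nat.two_pos Nat.two_pos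
    fun u v => xor u (!v)
  -- `O i` adds the last result to the cell of `C_i`, `C` copies the constant term to the cell `res`,
  -- and `X i` adds the value of `C_i` to it.
  obtain ⟨C, hCq, hC⟩ := hread (Sum.inl (Sum.inl ())) (Sum.inl (Sum.inl ())) Nat.two_pos
    Nat.two_pos fun u _ => u
  let jobs : List (Fin k × ℕ) :=
    (List.finRange k).flatMap fun i => (guesses (t i) L).map fun g => (i, g)
  have hjobs : ∀ j ∈ jobs, 1 ≤ j.2 ∧ j.2 ≤ t j.1 := by
    intro j hj
    obtain ⟨i, _, hj⟩ := List.mem_flatMap.1 hj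
    obtain ⟨g, hg, rfl⟩ := List.mem_map.1 hj
    exact one_le_and_le_of_mem_guesses hg
  let last : List (QuerySubroutine (withMemory (locSize n k t) (k + 2)) × Fin (k + 2)) :=
    (C, res) :: (List.finRange k).map fun i => (X i, res)
  refine ⟨⟨k + 2, orSteps S O tmp cell Prod.fst jobs ++ last, res⟩, ?_, fun P x => ?_⟩
  · have hrun : ((orSteps S O tmp cell Prod.fst jobs ++ last).map fun s => s.1.queries).sum =
        (jobs.map fun j => (S j).queries + 2).sum + (2 + 2 * k) := by
      rw [List.map_append, List.sum_append, orSteps, sum_map_flatMap]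
      simp [last, hOq, hCq, hXq, Function.comp_def, mul_comm]
    have hjob : (((jobs.map fun j => (S j).queries + 2).sum : ℕ) : ℝ) ≤
        96 * √((k : ℝ) * (∑ i, (t i : ℝ)) * L) := by
      calc (((jobs.map fun j => (S j).queries + 2).sum : ℕ) : ℝ)
          = (jobs.map fun j => (((S j).queries + 2 : ℕ) : ℝ)).sum := by
            rw [Nat.cast_list_sum, List.map_map]
            rfl
        _ ≤ (jobs.map fun j => 16 * √((t j.1 : ℝ) / j.2)).sum := by
            refine List.sum_le_sum fun j hj => ?_
            obtain ⟨h1, h2⟩ := hjobs j hj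
            have h := (hS j h1 h2).1
            have : 1 ≤ √((t j.1 : ℝ) / j.2) := by
              have h1' : (0 : ℝ) < j.2 := by exact_mod_cast h1
              rw [Real.one_le_sqrt, le_div_iff₀ h1', one_mul]
              exact_mod_cast h2
            push_cast
            linarith
        _ = ∑ i, 16 * ((guesses (t i) L).map fun g : ℕ => √((t i : ℝ) / g)).sum := by
            rw [sum_map_flatMap, Fin.sum_univ_def]
            simp only [List.map_map, Function.comp_def, List.sum_map_mul_left]
        _ ≤ ∑ i, 16 * (6 * √((t i : ℝ) * L)) := by
            refine Finset.sum_le_sum fun i _ => ?_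
            gcongr
            exact sum_sqrt_div_guesses_le hL1
        _ = 96 * ∑ i, √((t i : ℝ) * L) := by
            rw [Finset.mul_sum]
            exact Finset.sum_congr rfl fun i _ => by ring
        _ ≤ _ := by
            gcongr
            exact sum_sqrt_mul_le t L
    change ((((orSteps S O tmp cell Prod.fst jobs ++ last).map fun s => s.1.queries).sum : ℕ) : ℝ)
      ≤ _
    rw [hrun]
    have := cost_le (k := k) (L := L) (T := ∑ i, (t i : ℝ)) (by exact_mod_cast hk) (by positivity)
      (two_mul_clog_le hk)
    push_cast at hjob ⊢
    linarith
  · let fail : Fin k × ℕ → ℝ := fun j => missBound (P.falseCount j.1 x) j.2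
    have hfail0 : ∀ j, 0 ≤ fail j := fun j => missBound_nonneg _ _
    have hwrong0 : ∀ i b, 0 ≤ wrongBound Prod.fst (fun i => P.conj i x) fail [] i b := by
      intro i b
      rw [wrongBound_nil]
      split_ifs <;> norm_num
    have hlast : ∀ μ : Fin (k + 2) → Bool,
        runProb (P.input x) res (!P.eval x) last μ ≤
          ∑ i, wrongBound Prod.fst (fun i => P.conj i x) fail [] i (μ (cell i)) := by
      intro μ
      simp only [last]
      rw [runProb_cons_of_deterministic (v := P.a), runProb_accumulate_xor cell hres]
      · split_ifs with h
        · obtain ⟨i, hi⟩ : ∃ i, μ (cell i) ≠ !P.conj i x := by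
            by_contra! hall
            simp only [Function.update_self, Function.update_of_ne (hres _), hall,
              Bool.not_not] at h
            rw [eval, List.ofFn_eq_map] at h
            simp at h
          refine le_trans ?_ (Finset.single_le_sum (fun i _ => hwrong0 i (μ (cell i)))
            (Finset.mem_univ i))
          rw [wrongBound_nil, if_neg hi]
        · exact Finset.sum_nonneg fun i _ => hwrong0 i _
      · intro i μ v
        rw [hX, bitAt_joinMemory_inr, bitAt_joinMemory_inr]
      · intro v
        rw [hC, bitAt_input_constant]
    have hmain := runProb_orSteps_le (z := P.input x) (r := res) (b := !P.eval x) hcell htmp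
      (S := S) (O := O) (idx := Prod.fst) (C := fun i => P.conj i x) (fail := fail) (last := last)
      (fun i μ v => by
        rw [hO, bitAt_joinMemory_inr, bitAt_joinMemory_inr]) hfail0 hlast jobs
      (fun j hj h μ => ((hS j (hjobs j hj).1 (hjobs j hj).2).2 P x μ).1 h)
      (fun j hj μ => by
        obtain ⟨_, h2, h3⟩ := (hS j (hjobs j hj).1 (hjobs j hj).2).2 P x μ
        simp only [fail, missBound]
        split_ifs with a b
        · exact (h3 a).le
        · exact h2 b.1 b.2
        · linarith [(S j).outProb_true_add_false (joinMemory (P.input x) μ),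
            (S j).outProb_nonneg (joinMemory (P.input x) μ) true])
      (fun _ => false)
    refine hmain.trans ?_
    have hterm : ∀ i, wrongBound Prod.fst (fun i => P.conj i x) fail jobs i false ≤
        1 / (k : ℝ) ^ 2 := by
      intro i
      by_cases hc : P.conj i x = true
      · simp only [wrongBound, hc, if_true, Bool.false_eq_true, if_false]
        positivity
      · have h1 : 1 ≤ P.falseCount i x := by
          by_contra h0
          have h0 : P.falseCount i x = 0 := by omega
          apply hc
          simp only [falseCount, Finset.card_eq_zero, Finset.filter_eq_empty_iff] at h0
          simpa [conj] using h0
        have h2 : P.falseCount i x ≤ t i := by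
          have := Finset.card_filter_le (Finset.univ : Finset (Fin (t i)))
            fun z => x (P.idx i z) = false
          simpa [falseCount] using this
        simp only [wrongBound, hc, Bool.false_eq_true, if_false]
        have hprod := prod_map_flatMap_le
          (f := fun j : Fin k × ℕ => if j.1 = i then fail j else 1)
          (fun j => by split_ifs; exacts [hfail0 j, zero_le_one])
          (fun j => by split_ifs; exacts [missBound_le_one _ _, le_rfl])
          (fun i => (guesses (t i) L).map fun g => (i, g)) (List.mem_finRange i)
        refine hprod.trans ?_
        simp only [List.map_map, Function.comp_def, if_true, fail]
        exact (prod_missBound_guesses_le hL1 h1 h2).trans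
          (one_half_pow_two_mul_clog_le (by omega))
    calc _ ≤ ∑ _i : Fin k, 1 / (k : ℝ) ^ 2 := Finset.sum_le_sum fun i _ => hterm i
      _ = 1 / (k : ℝ) := by
        have : (k : ℝ) ≠ 0 := by positivity
        simp only [Finset.sum_const, Finset.card_univ, Fintype.card_fin, nsmul_eq_mul]
        field_simp

theorem corollary1 :
    ∃ K : ℝ, 0 < K ∧
      ∀ (n k : ℕ) (t : Fin k → ℕ), 1 ≤ k →
        ∃ A : QuantumAlgorithm (ZhegalkinPoly.locSize n k t),
          (A.runningTime : ℝ) ≤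
              K * Real.sqrt ((k : ℝ) * Real.log (k : ℝ) * ((k : ℝ) + ∑ i, (t i : ℝ))) ∧
          ∀ (P : ZhegalkinPoly n k t) (F : (Fin n → Bool) → Bool), P.Represents F →
            ∀ x : Fin n → Bool, A.errorProb (P.input x) (F x) ≤ K / (k : ℝ) := by
  refine ⟨300, by norm_num, fun n k t hk => ?_⟩
  have hk' : (0 : ℝ) < k := by exact_mod_cast hk
  obtain rfl | hk2 : k = 1 ∨ 2 ≤ k := by omega
  -- For `k = 1` no query is allowed, as `log 1 = 0`, and the bound on the error is void.
  · refine ⟨⟨1, [], 0⟩, by simp [QuantumAlgorithm.runningTime], fun P F _ x => ?_⟩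
    simp only [QuantumAlgorithm.errorProb, QuantumAlgorithm.returnProb, QuantumAlgorithm.runProb]
    split_ifs <;> norm_num
  · obtain ⟨A, hA, hA'⟩ := ZhegalkinPoly.exists_algorithm (n := n) t hk2
    refine ⟨A, hA, fun P F hF x => ?_⟩
    rw [hF x]
    exact (hA' P x).trans (by gcongr; norm_num)
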